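/- Let $U\subseteq\mathbb{R}^7$ be an open set (the domain of local coordinates $x=(x^1,\dots,x^7)$ on a seven-dimensional manifold) on which $x^1\neq 0$, and let $g_1,\dots,g_5$ be arbitrary smooth real functions with $g_i=g_i(x^1,x^2,x^3,x^4)$ for $i=1,2,3$, $g_4=g_4(x^5,x^6)$ and $g_5=g_5(x^7)$, defined and smooth on the corresponding coordinate projections of $U$. Consider on $U$ the operator field ($(1,1)$-tensor field) whose matrix (row index upper, column index lower) in the coordinates $x$ is $$ K=\begin{pmatrix} g_{1} & x^{1} & x^{1} + g_{2} & - x^{1} & x^{1} & -x^{1} & x^{1} \\ 1 & g_{5} & - g_{1} + g_{5} + x^{1} & g_{4} - g_{5} & 0 & g_{1} - g_{5} - x^{1} & - 1 - g_{4} + g_{5} \\ 0 & 0 & g_{1} & 0 & 0 & 0 & 0 \\ 1 + g_{1} - g_{4} & x^{1} & x^{1} + g_{2} & - 1 - x^{1} + g_{4} & x^{1} & -x^{1} & x^{1} \\ 0 & g_{1} - g_{5} & g_{1} + g_{3} - g_{5} + \frac{1}{x^{1}} & - g_{1} + g_{5} & g_{1} & - g_{1} + g_{5} - \frac{1}{x^{1}}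 & g_{1} - g_{5} \\ 0 & 0 & x^{1} & 0 & 0 & g_{1} - x^{1} & 0 \\ g_{1} - g_{4} & x^{1} & x^{1} + g_{2} & - 1 - x^{1} & x^{1} & -x^{1} & 1 + x^{1} + g_{4} \end{pmatrix}. $$ For smooth vector fields $X,Y$ on $U$, the generalized Nijenhuis torsions of $K$ are defined recursively by $\tau^{(0)}_K(X,Y)=[X,Y]$ and, for $m\ge 1$, $$ \tau^{(m)}_K(X,Y)=K^2\tau^{(m-1)}_K(X,Y)+\tau^{(m-1)}_K(KX,KY)-K\bigl(\tau^{(m-1)}_K(X,KY)+\tau^{(m-1)}_K(KX,Y)\bigr). $$ Then: 1. $\tau^{(4)}_K(X,Y)=0$ on $U$ for all smooth vector fields $X,Y$ on $U$. 2. The level-$3$ torsion does not vanish wherever $g_3\neq 0$: for every $x\in U$ at which $g_3\ne 0$ there are smooth vector fields $X,Y$ on $U$ with $\tau^{(3)}_K(X,Y)(x)\neq 0$. -/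

import Mathlib

open scoped ContDiff

noncomputable section

/-- The action of a (1,1)-tensor field `A`, given by its matrix `A x` (row index upper, column
index lower) in the coordinates of `ℝⁿ`, on a vector field `X`. -/
def opApply {n : ℕ} (A : (Fin n → ℝ) → Matrix (Fin n) (Fin n) ℝ)
    (X : (Fin n → ℝ) → (Fin n → ℝ)) : (Fin n → ℝ) → (Fin n → ℝ) :=
  fun x => (A x).mulVec (X x)

/-- The generalized Nijenhuis torsion of level `m` of the operator field `A`, evaluated on the
vector fields `X`, `Y`. Level `0` is the commutator `[X, Y] = DY(X) - DX(Y)`, level `1` is the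
Nijenhuis torsion, level `2` is the Haantjes torsion. -/
def genTorsion {n : ℕ} (A : (Fin n → ℝ) → Matrix (Fin n) (Fin n) ℝ) :
    ℕ → ((Fin n → ℝ) → (Fin n → ℝ)) → ((Fin n → ℝ) → (Fin n → ℝ)) →
      ((Fin n → ℝ) → (Fin n → ℝ))
  | 0, X, Y => VectorField.lieBracket ℝ X Y
  | m + 1, X, Y =>
      opApply A (opApply A (genTorsion A m X Y))
        + genTorsion A m (opApply A X) (opApply A Y)
        - opApply A (genTorsion A m X (opApply A Y) + genTorsion A m (opApply A X) Y)

/-- The coordinates `(x¹, x², x³, x⁴)` of a point of `ℝ⁷` (which has indices `0, …, 6`). -/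
def proj1234 (x : Fin 7 → ℝ) : Fin 4 → ℝ := ![x 0, x 1, x 2, x 3]

/-- The coordinates `(x⁵, x⁶)` of a point of `ℝ⁷`. -/
def proj56 (x : Fin 7 → ℝ) : Fin 2 → ℝ := ![x 4, x 5]

/-- The coordinate `x⁷` of a point of `ℝ⁷`. -/
def proj7 (x : Fin 7 → ℝ) : ℝ := x 6

/-- The value of the `7 × 7` family at a point with first coordinate `t`, where the five functions
take the values `a₁, …, a₅`. -/
def levelFourMatrix (t a₁ a₂ a₃ a₄ a₅ : ℝ) : Matrix (Fin 7) (Fin 7) ℝ :=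
  !![a₁, t, t + a₂, -t, t, -t, t;
     1, a₅, -a₁ + a₅ + t, a₄ - a₅, 0, a₁ - a₅ - t, -1 - a₄ + a₅;
     0, 0, a₁, 0, 0, 0, 0;
     1 + a₁ - a₄, t, t + a₂, -1 - t + a₄, t, -t, t;
     0, a₁ - a₅, a₁ + a₃ - a₅ + 1 / t, -a₁ + a₅, a₁, -a₁ + a₅ - 1 / t, a₁ - a₅;
     0, 0, t, 0, 0, a₁ - t, 0;
     a₁ - a₄, t, t + a₂, -1 - t, t, -t, 1 + t + a₄]

/-- The `7 × 7` family of operator fields with functions `g₁, g₂, g₃` of `(x¹, x², x³, x⁴)`,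
`g₄` of `(x⁵, x⁶)` and `g₅` of `x⁷`. -/
def levelFourFamily (g₁ g₂ g₃ : (Fin 4 → ℝ) → ℝ) (g₄ : (Fin 2 → ℝ) → ℝ) (g₅ : ℝ → ℝ)
    (x : Fin 7 → ℝ) : Matrix (Fin 7) (Fin 7) ℝ :=
  levelFourMatrix (x 0) (g₁ (proj1234 x)) (g₂ (proj1234 x)) (g₃ (proj1234 x))
    (g₄ (proj56 x)) (g₅ (proj7 x))

end

/-! From level 1 on the torsion is tensorial: at a point it depends only on the values of `X`, `Y`,
on `K` and on the first derivative of `K` there (`genTorsion_succ_apply`). The theorem thus becomes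
pointwise algebra, unchanged by a constant change of frame (`pointTorsion_semiconj`). In the frame
`frameVec` the operator is upper triangular with diagonal a₁, a₁, a₁, a₁ - t, a₅, a₄ - 1, a₄ + 1. If
`K` were diagonal with eigenvalues λ, each step of the recursion would multiply the eₖ-coefficient
of cᵢdⱼ - cⱼdᵢ by (λₖ - λᵢ)(λₖ - λⱼ). Because a₁ is repeated, nearly everything dies; the
off-diagonal entries leave at level 3 only a multiple of g₃t²(c₂d₃ - c₃d₂)e₀, and the next step
kills it. -/

/-- The `m`-th iterate of the recursion of the generalized Nijenhuis torsions at a point, starting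
from the Nijenhuis torsion of an operator `K` whose derivative in direction `u` is `D u`. -/
def pointTorsion {V : Type*} [AddCommGroup V] (K : V → V) (D : V → V → V) : ℕ → V → V → V
  | 0, u, v => D (K u) v - D (K v) u - K (D u v - D v u)
  | m + 1, u, v =>
      K (K (pointTorsion K D m u v)) + pointTorsion K D m (K u) (K v)
        - K (pointTorsion K D m u (K v) + pointTorsion K D m (K u) v)

/-- The recursion uses only sums, `K` and `D`, so an additive intertwiner passes through it. The
frame is constant, so `D` transforms without an extra term. -/
theorem pointTorsion_semiconj {V W : Type*} [AddCommGroup V] [AddCommGroup W] (φ : V →+ W)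
    {K : V → V} {D : V → V → V} {K' : W → W} {D' : W → W → W}
    (hK : ∀ u, K' (φ u) = φ (K u)) (hD : ∀ u v, D' (φ u) (φ v) = φ (D u v)) (m : ℕ) (u v : V) :
    pointTorsion K' D' m (φ u) (φ v) = φ (pointTorsion K D m u v) := by
  induction m generalizing u v with
  | zero => simp only [pointTorsion, hK, hD, ← map_sub]
  | succ m ih => simp only [pointTorsion, hK, ih, ← map_sub, ← map_add]

theorem hasFDerivAt_opApply {n : ℕ} {A : (Fin n → ℝ) → Matrix (Fin n) (Fin n) ℝ}
    {A' : (Fin n → ℝ) → Matrix (Fin n) (Fin n) ℝ} {x : Fin n → ℝ}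
    (hA : ∀ i j, ∃ L : (Fin n → ℝ) →L[ℝ] ℝ,
      HasFDerivAt (fun y => A y i j) L x ∧ ∀ u, L u = A' u i j)
    {X : (Fin n → ℝ) → (Fin n → ℝ)} (hX : DifferentiableAt ℝ X x) :
    DifferentiableAt ℝ (opApply A X) x ∧
      ∀ u, fderiv ℝ (opApply A X) x u
        = (A' u).mulVec (X x) + (A x).mulVec (fderiv ℝ X x u) := by
  choose L hL hLA using hA
  have hXj : ∀ j, HasFDerivAt (fun y => X y j)
      ((ContinuousLinearMap.proj j).comp (fderiv ℝ X x)) x := fun j =>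
    (hasFDerivAt_pi'.1 hX.hasFDerivAt) j
  have h : HasFDerivAt (opApply A X) (ContinuousLinearMap.pi fun i =>
      ∑ j, (A x i j • (ContinuousLinearMap.proj j).comp (fderiv ℝ X x) + X x j • L i j)) x := by
    rw [hasFDerivAt_pi]
    intro i
    simp only [opApply, Matrix.mulVec, dotProduct]
    exact HasFDerivAt.fun_sum fun j _ => (hL i j).mul (hXj j)
  refine ⟨h.differentiableAt, fun u => ?_⟩
  rw [h.fderiv]
  ext i
  simp only [ContinuousLinearMap.coe_pi', sum_apply,
    add_apply, smul_apply, ContinuousLinearMap.comp_apply,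
    ContinuousLinearMap.proj_apply, Pi.add_apply, Matrix.mulVec, dotProduct, hLA, smul_eq_mul,
    ← Finset.sum_add_distrib]
  exact Finset.sum_congr rfl fun j _ => by ring

/-- The derivatives of `X` and `Y` cancel at level 1, and later levels are purely algebraic. Index
`m` of `pointTorsion` is therefore level `m + 1`. -/
theorem genTorsion_succ_apply {n : ℕ} {A : (Fin n → ℝ) → Matrix (Fin n) (Fin n) ℝ}
    {A' : (Fin n → ℝ) → Matrix (Fin n) (Fin n) ℝ} {x : Fin n → ℝ}
    (hA : ∀ i j, ∃ L : (Fin n → ℝ) →L[ℝ] ℝ,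
      HasFDerivAt (fun y => A y i j) L x ∧ ∀ u, L u = A' u i j)
    (m : ℕ) {X Y : (Fin n → ℝ) → (Fin n → ℝ)}
    (hX : DifferentiableAt ℝ X x) (hY : DifferentiableAt ℝ Y x) :
    genTorsion A (m + 1) X Y x
      = pointTorsion (A x).mulVec (fun u v => (A' u).mulVec v) m (X x) (Y x) := by
  induction m generalizing X Y with
  | zero =>
    obtain ⟨-, h1⟩ := hasFDerivAt_opApply hA hX
    obtain ⟨-, h2⟩ := hasFDerivAt_opApply hA hY
    simp only [genTorsion, pointTorsion, Pi.add_apply, Pi.sub_apply, VectorField.lieBracket, h1, h2,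
      opApply, Matrix.mulVec_add, Matrix.mulVec_sub]
    abel
  | succ m ih =>
    have h1 := (hasFDerivAt_opApply hA hX).1
    have h2 := (hasFDerivAt_opApply hA hY).1
    have e : ∀ Z : (Fin n → ℝ) → (Fin n → ℝ), opApply A Z x = (A x).mulVec (Z x) := fun _ => rfl
    rw [genTorsion]
    simp only [pointTorsion, Pi.add_apply, Pi.sub_apply, e, ih hX hY, ih h1 h2, ih hX h2, ih h1 hY]

/-! ### Differentials of the matrix entries -/

/-- The part of `levelFourMatrix` that is linear in `t`, `1 / t` and `a₁, …, a₅`. -/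
def levelFourLinear (t s a₁ a₂ a₃ a₄ a₅ : ℝ) : Matrix (Fin 7) (Fin 7) ℝ :=
  !![a₁, t, t + a₂, -t, t, -t, t;
     0, a₅, -a₁ + a₅ + t, a₄ - a₅, 0, a₁ - a₅ - t, - a₄ + a₅;
     0, 0, a₁, 0, 0, 0, 0;
     a₁ - a₄, t, t + a₂, -t + a₄, t, -t, t;
     0, a₁ - a₅, a₁ + a₃ - a₅ + s, -a₁ + a₅, a₁, -a₁ + a₅ - s, a₁ - a₅;
     0, 0, t, 0, 0, a₁ - t, 0;
     a₁ - a₄, t, t + a₂, -t, t, -t, t + a₄]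

set_option maxHeartbeats 1000000 in
theorem levelFourLinear_eq_sum (t s a₁ a₂ a₃ a₄ a₅ : ℝ) :
    levelFourLinear t s a₁ a₂ a₃ a₄ a₅ = t • levelFourLinear 1 0 0 0 0 0 0
      + s • levelFourLinear 0 1 0 0 0 0 0 + a₁ • levelFourLinear 0 0 1 0 0 0 0
      + a₂ • levelFourLinear 0 0 0 1 0 0 0 + a₃ • levelFourLinear 0 0 0 0 1 0 0
      + a₄ • levelFourLinear 0 0 0 0 0 1 0 + a₅ • levelFourLinear 0 0 0 0 0 0 1 := by
  ext i j
  fin_cases i <;> fin_cases j <;> simp [levelFourLinear] <;> ring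

/-- The constant part is the value at zero, because `1 / 0 = 0`. -/
theorem levelFourMatrix_eq_linear_add (t a₁ a₂ a₃ a₄ a₅ : ℝ) :
    levelFourMatrix t a₁ a₂ a₃ a₄ a₅
      = levelFourLinear t t⁻¹ a₁ a₂ a₃ a₄ a₅ + levelFourMatrix 0 0 0 0 0 0 := by
  ext i j
  fin_cases i <;> fin_cases j <;> simp [levelFourLinear, levelFourMatrix] <;> ring

/-- The entries are affine in `t`, `1 / t` and the `aᵢ`, so their differential is the linear part
evaluated at the differentials of these quantities. -/
theorem hasFDerivAt_levelFourMatrix_entry {E : Type*} [NormedAddCommGroup E] [NormedSpace ℝ E]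
    {t a₁ a₂ a₃ a₄ a₅ : E → ℝ} {t' a₁' a₂' a₃' a₄' a₅' : E →L[ℝ] ℝ} {x : E}
    (h0 : t x ≠ 0) (ht : HasFDerivAt t t' x) (h₁ : HasFDerivAt a₁ a₁' x)
    (h₂ : HasFDerivAt a₂ a₂' x) (h₃ : HasFDerivAt a₃ a₃' x) (h₄ : HasFDerivAt a₄ a₄' x)
    (h₅ : HasFDerivAt a₅ a₅' x) (i j : Fin 7) :
    ∃ L : E →L[ℝ] ℝ, HasFDerivAt
        (fun y => levelFourMatrix (t y) (a₁ y) (a₂ y) (a₃ y) (a₄ y) (a₅ y) i j) L x ∧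
      ∀ u, L u = levelFourLinear (t' u) (-(t x ^ 2)⁻¹ * t' u) (a₁' u) (a₂' u) (a₃' u) (a₄' u)
        (a₅' u) i j := by
  have hs : HasFDerivAt (fun y => (t y)⁻¹) (-(t x ^ 2)⁻¹ • t') x :=
    (hasDerivAt_inv h0).comp_hasFDerivAt x ht
  have key := (((((((ht.mul_const (levelFourLinear 1 0 0 0 0 0 0 i j)).add
    (hs.mul_const (levelFourLinear 0 1 0 0 0 0 0 i j))).add
    (h₁.mul_const (levelFourLinear 0 0 1 0 0 0 0 i j))).add
    (h₂.mul_const (levelFourLinear 0 0 0 1 0 0 0 i j))).add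
    (h₃.mul_const (levelFourLinear 0 0 0 0 1 0 0 i j))).add
    (h₄.mul_const (levelFourLinear 0 0 0 0 0 1 0 i j))).add
    (h₅.mul_const (levelFourLinear 0 0 0 0 0 0 1 i j))).add_const (levelFourMatrix 0 0 0 0 0 0 i j)
  refine ⟨_, key.congr_of_eventuallyEq (Filter.Eventually.of_forall fun y => ?_), fun u => ?_⟩
  · dsimp only
    rw [levelFourMatrix_eq_linear_add, levelFourLinear_eq_sum]
    simp [smul_eq_mul]
  · rw [levelFourLinear_eq_sum (t' u)]
    simp [smul_eq_mul]
    ring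

/-! ### The triangular frame and the torsions in it -/

/-- The vector with coordinates `c` in a constant frame in which `levelFourMatrix` is triangular. -/
def frameVec : (Fin 7 → ℝ) →+ (Fin 7 → ℝ) where
  toFun c := ![c 0, c 3 + c 4 + c 5 + c 6, c 2, c 0 + 2 * c 5, c 1 - c 4, c 2 + c 3,
    c 0 + c 5 - c 6]
  map_zero' := by ext i; fin_cases i <;> simp
  map_add' c d := by ext i; fin_cases i <;> simp <;> ring

theorem frameVec_surjective : Function.Surjective frameVec := fun u =>
  -- Back substitution: c₅ = (u₃ - u₀)/2, c₆ = u₀ + c₅ - u₆, c₃ = u₅ - u₂, c₄ = u₁ - c₃ - c₅ - c₆,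
  -- c₁ = u₄ + c₄.
  ⟨![u 0, u 4 + (u 1 - (u 5 - u 2) - (u 3 - u 0) / 2 - (u 0 + (u 3 - u 0) / 2 - u 6)), u 2,
    u 5 - u 2, u 1 - (u 5 - u 2) - (u 3 - u 0) / 2 - (u 0 + (u 3 - u 0) / 2 - u 6),
    (u 3 - u 0) / 2, u 0 + (u 3 - u 0) / 2 - u 6], by
    ext i; fin_cases i <;> simp [frameVec] <;> ring⟩

/-- `levelFourMatrix` in the frame of `frameVec`, with `s` in place of `1 / t`. -/
def frameOp (t s a₁ a₂ a₃ a₄ a₅ : ℝ) (c : Fin 7 → ℝ) : Fin 7 → ℝ :=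
  ![a₁ * c 0 + t * c 1 + a₂ * c 2, a₁ * c 1 + a₃ * c 2 - s * c 3, a₁ * c 2, (a₁ - t) * c 3,
    a₅ * c 4, (a₄ - 1) * c 5, (a₄ + 1) * c 6]

theorem levelFourMatrix_mulVec_frameVec (t a₁ a₂ a₃ a₄ a₅ : ℝ) (c : Fin 7 → ℝ) :
    (levelFourMatrix t a₁ a₂ a₃ a₄ a₅).mulVec (frameVec c)
      = frameVec (frameOp t t⁻¹ a₁ a₂ a₃ a₄ a₅ c) := by
  ext i
  fin_cases i <;>
    simp [levelFourMatrix, frameVec, frameOp, Matrix.mulVec, dotProduct, Fin.sum_univ_succ] <;> ring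

/-- `levelFourLinear` in the frame of `frameVec`. -/
def frameLinear (t s a₁ a₂ a₃ a₄ a₅ : ℝ) (c : Fin 7 → ℝ) : Fin 7 → ℝ :=
  ![a₁ * c 0 + t * c 1 + a₂ * c 2, a₁ * c 1 + a₃ * c 2 - s * c 3, a₁ * c 2, (a₁ - t) * c 3,
    a₅ * c 4, a₄ * c 5, a₄ * c 6]

theorem levelFourLinear_mulVec_frameVec (t s a₁ a₂ a₃ a₄ a₅ : ℝ) (c : Fin 7 → ℝ) :
    (levelFourLinear t s a₁ a₂ a₃ a₄ a₅).mulVec (frameVec c)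
      = frameVec (frameLinear t s a₁ a₂ a₃ a₄ a₅ c) := by
  ext i
  fin_cases i <;>
    simp [levelFourLinear, frameVec, frameLinear, Matrix.mulVec, dotProduct, Fin.sum_univ_succ] <;>
    ring

/-- The derivative of `frameOp` in the direction `c` when the differentials of `a₁, a₂, a₃` have
components `p`, `q`, `r` along the first four coordinates, the one of `a₄` has components `y`, `z`
along the fifth and sixth, and the one of `a₅` has component `k` along the seventh. -/
noncomputable def frameDeriv (t : ℝ) (p q r : Fin 4 → ℝ) (y z k : ℝ) (c : Fin 7 → ℝ) :
    (Fin 7 → ℝ) → (Fin 7 → ℝ) :=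
  frameLinear (c 0) (-(t ^ 2)⁻¹ * c 0)
    (p 0 * c 0 + p 1 * (c 3 + c 4 + c 5 + c 6) + p 2 * c 2 + p 3 * (c 0 + 2 * c 5))
    (q 0 * c 0 + q 1 * (c 3 + c 4 + c 5 + c 6) + q 2 * c 2 + q 3 * (c 0 + 2 * c 5))
    (r 0 * c 0 + r 1 * (c 3 + c 4 + c 5 + c 6) + r 2 * c 2 + r 3 * (c 0 + 2 * c 5))
    (y * (c 1 - c 4) + z * (c 2 + c 3)) (k * (c 0 + c 5 - c 6))

-- This is level 2. Of the differentials of the five functions only `r`, that of g₃, survives, and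
-- only in terms containing c₂ or d₂.
set_option maxHeartbeats 4000000 in
theorem pointTorsion_one_frame {t : ℝ} (ht : t ≠ 0) (a₁ a₂ a₃ a₄ a₅ : ℝ) (p q r : Fin 4 → ℝ)
    (y z k : ℝ) (c d : Fin 7 → ℝ) :
    pointTorsion (frameOp t t⁻¹ a₁ a₂ a₃ a₄ a₅) (frameDeriv t p q r y z k) 1 c d
      = ![4 * t * (c 1 * d 3 - c 3 * d 1)
          + (4 * a₂ - a₃ - r 0 * t + r 1 * t ^ 3 - r 3 * t) * (c 2 * d 3 - c 3 * d 2)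
          + r 1 * t * (a₁ - a₅) ^ 2 * (c 2 * d 4 - c 4 * d 2)
          + (r 1 + 2 * r 3) * t * (a₁ - a₄ + 1) ^ 2 * (c 2 * d 5 - c 5 * d 2)
          + r 1 * t * (a₁ - a₄ - 1) ^ 2 * (c 2 * d 6 - c 6 * d 2),
        -2 * a₃ * (c 2 * d 3 - c 3 * d 2), 0, 0, 0, 0, 0] := by
  ext i
  fin_cases i <;> simp [pointTorsion, frameOp, frameDeriv, frameLinear] <;> field_simp <;> ring

/-- In the e₀-component every term with c₂ dies, since e₀ and the coordinate c₂ share the eigenvalue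
a₁. The term in c₁d₃ - c₃d₁ contributes -4a₃t² through the entry a₃, and the e₁-component
contributes -2a₃t² through the entry t. -/
theorem pointTorsion_two_frame {t : ℝ} (ht : t ≠ 0) (a₁ a₂ a₃ a₄ a₅ : ℝ) (p q r : Fin 4 → ℝ)
    (y z k : ℝ) (c d : Fin 7 → ℝ) :
    pointTorsion (frameOp t t⁻¹ a₁ a₂ a₃ a₄ a₅) (frameDeriv t p q r y z k) 2 c d
      = ![-6 * a₃ * t ^ 2 * (c 2 * d 3 - c 3 * d 2), 0, 0, 0, 0, 0, 0] := by
  rw [pointTorsion]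
  simp only [pointTorsion_one_frame ht]
  ext i
  fin_cases i <;> simp [frameOp] <;> (field_simp; ring)

/-- The factor (λ₀ - λ₂)(λ₀ - λ₃) vanishes because λ₀ = λ₂ = a₁. -/
theorem pointTorsion_three_frame {t : ℝ} (ht : t ≠ 0) (a₁ a₂ a₃ a₄ a₅ : ℝ) (p q r : Fin 4 → ℝ)
    (y z k : ℝ) (c d : Fin 7 → ℝ) :
    pointTorsion (frameOp t t⁻¹ a₁ a₂ a₃ a₄ a₅) (frameDeriv t p q r y z k) 3 c d = 0 := by
  rw [pointTorsion]
  simp only [pointTorsion_two_frame ht]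
  ext i
  fin_cases i <;> simp [frameOp]
  ring

/-! ### Differentials of the five functions and conclusion -/

theorem hasFDerivAt_comp_linear {m : ℕ} {U : Set (Fin 7 → ℝ)} (hU : IsOpen U) {x : Fin 7 → ℝ}
    (hx : x ∈ U) (P : (Fin 7 → ℝ) →ₗ[ℝ] (Fin m → ℝ)) (hP : Function.Surjective P)
    {g : (Fin m → ℝ) → ℝ} (hg : ContDiffOn ℝ ∞ g (P '' U)) :
    ∃ p : Fin m → ℝ, ∃ L : (Fin 7 → ℝ) →L[ℝ] ℝ, HasFDerivAt (fun y => g (P y)) L x ∧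
      ∀ u, L u = ∑ j, p j * P u j := by
  -- A surjective linear map is open, so smoothness on the projection of `U` gives differentiability
  -- at the point.
  have hopen : IsOpen (P '' U) :=
    (LinearMap.toContinuousLinearMap P).isOpenMap hP U hU
  have hd : DifferentiableAt ℝ g (P x) :=
    (hg.contDiffAt (hopen.mem_nhds ⟨x, hx, rfl⟩)).differentiableAt (by simp)
  have hPx : HasFDerivAt P (LinearMap.toContinuousLinearMap P) x :=
    (LinearMap.toContinuousLinearMap P).hasFDerivAt
  refine ⟨fun j => fderiv ℝ g (P x) (Pi.single j 1), _, hd.hasFDerivAt.comp x hPx, fun u => ?_⟩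
  change fderiv ℝ g (P x) (P u) = _
  conv_lhs => rw [pi_eq_sum_univ' (P u)]
  simp [mul_comm]

theorem exists_hasFDerivAt_levelFourFamily {U : Set (Fin 7 → ℝ)} (hU : IsOpen U)
    {x : Fin 7 → ℝ} (hxU : x ∈ U) (hx : x 0 ≠ 0)
    {g₁ g₂ g₃ : (Fin 4 → ℝ) → ℝ} {g₄ : (Fin 2 → ℝ) → ℝ} {g₅ : ℝ → ℝ}
    (hg₁ : ContDiffOn ℝ ∞ g₁ (proj1234 '' U)) (hg₂ : ContDiffOn ℝ ∞ g₂ (proj1234 '' U))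
    (hg₃ : ContDiffOn ℝ ∞ g₃ (proj1234 '' U)) (hg₄ : ContDiffOn ℝ ∞ g₄ (proj56 '' U))
    (hg₅ : ContDiffOn ℝ ∞ g₅ (proj7 '' U)) :
    ∃ (A' : (Fin 7 → ℝ) → Matrix (Fin 7) (Fin 7) ℝ) (p q r : Fin 4 → ℝ) (y z k : ℝ),
      (∀ i j, ∃ L : (Fin 7 → ℝ) →L[ℝ] ℝ,
        HasFDerivAt (fun w => levelFourFamily g₁ g₂ g₃ g₄ g₅ w i j) L x ∧ ∀ u, L u = A' u i j) ∧
      ∀ c d, (A' (frameVec c)).mulVec (frameVec d)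
        = frameVec (frameDeriv (x 0) p q r y z k c d) := by
  let P : (Fin 7 → ℝ) →ₗ[ℝ] (Fin 4 → ℝ) :=
    { toFun := proj1234
      map_add' := fun u v => by ext i; fin_cases i <;> simp [proj1234]
      map_smul' := fun a u => by ext i; fin_cases i <;> simp [proj1234] }
  let Q : (Fin 7 → ℝ) →ₗ[ℝ] (Fin 2 → ℝ) :=
    { toFun := proj56
      map_add' := fun u v => by ext i; fin_cases i <;> simp [proj56]
      map_smul' := fun a u => by ext i; fin_cases i <;> simp [proj56] }
  have hP : Function.Surjective P := fun w =>
    ⟨![w 0, w 1, w 2, w 3, 0, 0, 0], by ext i; fin_cases i <;> simp [P, proj1234]⟩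
  have hQ : Function.Surjective Q := fun w =>
    ⟨![0, 0, 0, 0, w 0, w 1, 0], by ext i; fin_cases i <;> simp [Q, proj56]⟩
  obtain ⟨p, L₁, h₁, hL₁⟩ := hasFDerivAt_comp_linear hU hxU P hP hg₁
  obtain ⟨q, L₂, h₂, hL₂⟩ := hasFDerivAt_comp_linear hU hxU P hP hg₂
  obtain ⟨r, L₃, h₃, hL₃⟩ := hasFDerivAt_comp_linear hU hxU P hP hg₃
  obtain ⟨s, L₄, h₄, hL₄⟩ := hasFDerivAt_comp_linear hU hxU Q hQ hg₄
  have h₅ : HasFDerivAt (fun w => g₅ (proj7 w))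
      (deriv g₅ (x 6) • ContinuousLinearMap.proj (R := ℝ) (φ := fun _ : Fin 7 => ℝ) 6) x := by
    have hopen : IsOpen (proj7 '' U) := isOpenMap_eval (6 : Fin 7) U hU
    have hd : DifferentiableAt ℝ g₅ (x 6) :=
      (hg₅.contDiffAt (hopen.mem_nhds ⟨x, hxU, rfl⟩)).differentiableAt (by simp)
    exact hd.hasDerivAt.comp_hasFDerivAt x (hasFDerivAt_apply (6 : Fin 7) x)
  refine ⟨_, p, q, r, s 0, s 1, deriv g₅ (x 6),
    hasFDerivAt_levelFourMatrix_entry hx (hasFDerivAt_apply (0 : Fin 7) x) h₁ h₂ h₃ h₄ h₅,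
    fun c d => ?_⟩
  rw [levelFourLinear_mulVec_frameVec, frameDeriv]
  simp [hL₁, hL₂, hL₃, hL₄, Fin.sum_univ_succ, P, Q, proj1234, proj56, frameVec, add_assoc]

theorem mainTheorem5 (U : Set (Fin 7 → ℝ)) (hU : IsOpen U) (hx : ∀ x ∈ U, x 0 ≠ 0)
    (g₁ g₂ g₃ : (Fin 4 → ℝ) → ℝ) (g₄ : (Fin 2 → ℝ) → ℝ) (g₅ : ℝ → ℝ)
    (hg₁ : ContDiffOn ℝ ∞ g₁ (proj1234 '' U))
    (hg₂ : ContDiffOn ℝ ∞ g₂ (proj1234 '' U))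
    (hg₃ : ContDiffOn ℝ ∞ g₃ (proj1234 '' U))
    (hg₄ : ContDiffOn ℝ ∞ g₄ (proj56 '' U))
    (hg₅ : ContDiffOn ℝ ∞ g₅ (proj7 '' U)) :
    (∀ X Y : (Fin 7 → ℝ) → (Fin 7 → ℝ), ContDiffOn ℝ ∞ X U → ContDiffOn ℝ ∞ Y U →
      ∀ x ∈ U, genTorsion (levelFourFamily g₁ g₂ g₃ g₄ g₅) 4 X Y x = 0) ∧
    (∀ x ∈ U, g₃ (proj1234 x) ≠ 0 →
      ∃ X Y : (Fin 7 → ℝ) → (Fin 7 → ℝ), ContDiffOn ℝ ∞ X U ∧ ContDiffOn ℝ ∞ Y U ∧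
        genTorsion (levelFourFamily g₁ g₂ g₃ g₄ g₅) 3 X Y x ≠ 0) := by
  have main : ∀ x ∈ U, ∃ (p q r : Fin 4 → ℝ) (y z k : ℝ), ∀ (m : ℕ)
      (X Y : (Fin 7 → ℝ) → (Fin 7 → ℝ)) (c d : Fin 7 → ℝ), DifferentiableAt ℝ X x →
      DifferentiableAt ℝ Y x → X x = frameVec c → Y x = frameVec d →
      genTorsion (levelFourFamily g₁ g₂ g₃ g₄ g₅) (m + 1) X Y x
        = frameVec (pointTorsion
          (frameOp (x 0) (x 0)⁻¹ (g₁ (proj1234 x)) (g₂ (proj1234 x)) (g₃ (proj1234 x))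
            (g₄ (proj56 x)) (g₅ (proj7 x))) (frameDeriv (x 0) p q r y z k) m c d) := by
    intro x hxU
    obtain ⟨A', p, q, r, y, z, k, hA, hD⟩ :=
      exists_hasFDerivAt_levelFourFamily hU hxU (hx x hxU) hg₁ hg₂ hg₃ hg₄ hg₅
    refine ⟨p, q, r, y, z, k, fun m X Y c d hX hY hc hd => ?_⟩
    rw [genTorsion_succ_apply hA m hX hY, hc, hd]
    exact pointTorsion_semiconj frameVec (levelFourMatrix_mulVec_frameVec _ _ _ _ _ _) hD m c d
  constructor
  · intro X Y hX hY x hxU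
    obtain ⟨p, q, r, y, z, k, h⟩ := main x hxU
    obtain ⟨c, hc⟩ := frameVec_surjective (X x)
    obtain ⟨d, hd⟩ := frameVec_surjective (Y x)
    -- Index 3 is level 4.
    rw [h 3 X Y c d ((hX.contDiffAt (hU.mem_nhds hxU)).differentiableAt (by simp))
      ((hY.contDiffAt (hU.mem_nhds hxU)).differentiableAt (by simp)) hc.symm hd.symm,
      pointTorsion_three_frame (hx x hxU), map_zero]
  · intro x hxU hg
    obtain ⟨p, q, r, y, z, k, h⟩ := main x hxU
    -- The level 3 torsion is a multiple of c₂d₃ - c₃d₂, which equals 1 on this pair of constant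
    -- fields.
    refine ⟨fun _ => frameVec (Pi.single 2 1), fun _ => frameVec (Pi.single 3 1),
      contDiffOn_const, contDiffOn_const, fun h0 => ?_⟩
    rw [h 2 _ _ _ _ (differentiableAt_const _) (differentiableAt_const _) rfl rfl,
      pointTorsion_two_frame (hx x hxU)] at h0
    have h1 := congrFun h0 0
    simp [frameVec, hg, hx x hxU] at h1
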